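/- Graphs are finite undirected graphs without loops, possibly with parallel edges; a graph is cubic if every vertex is incident with exactly three edges. For real numbers $r\ge 2$ and $\alpha\ge 0$, a graph $G=(V,E)$ admits an $(r,\alpha)$-flow if there are an orientation of $G$ and a function $f:E\to[1,r-1]$ such that for every vertex $x$ $$\Bigl|\sum_{e\in E^+(x)}f(e)-\sum_{e\in E^-(x)}f(e)\Bigr|\le\alpha,$$ where $E^+(x)$ and $E^-(x)$ are the sets of edges directed from $x$ and toward $x$, respectively. Write $(r,\alpha)\preceq(s,\beta)$ if every cubic graph that admits an $(r,\alpha)$-flow also admits an $(s,\beta)$-flow, and call $(r,\alpha)$ and $(s,\beta)$ equivalent if $(r,\alpha)\preceq(s,\beta)$ and $(s,\beta)\preceq(r,\alpha)$. Theorem. The $r$-$\alpha$ plane $\{(r,\alpha)\in\mathbb{R}^2 : r\ge 2,\ \alpha\ge 0\}$ contains an infinite set of pairwise non-equivalent points. In particular, no two distinct points (with rational or irrational coordinates) on the closed line segment from $(4,0)$ to $(5,0)$ are equivalent. -/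

import Mathlib

namespace BoundedExcess

open scoped Graph

/-- A finite cubic multigraph: finitely many vertices, no loops (parallel edges are allowed), and
every vertex is incident with exactly three edges. -/
structure IsCubic {V E : Type} (G : Graph V E) : Prop where
  finite_vertexSet : V(G).Finite
  loopless : G.Loopless
  ncard_incidenceSet : ∀ x ∈ V(G), (G.incidenceSet x).ncard = 3

/-- An orientation of a multigraph: every edge is directed from one of its ends, its tail,
toward the other one, its head. -/
structure Orientation {V E : Type} (G : Graph V E) where
  tail : E(G) → V
  head : E(G) → V
  isLink : ∀ e : E(G), G.IsLink e (tail e) (head e)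

/-- The set of edges directed from `x`. -/
def Orientation.outEdges {V E : Type} {G : Graph V E} (D : Orientation G) (x : V) : Set E(G) :=
  {e | D.tail e = x}

/-- The set of edges directed toward `x`. -/
def Orientation.inEdges {V E : Type} {G : Graph V E} (D : Orientation G) (x : V) : Set E(G) :=
  {e | D.head e = x}

/-- `f` is an `(r, α)`-bounded excess flow in the oriented graph `D`. The sums are finite sums
when the graph is finite. -/
structure IsFlow {V E : Type} {G : Graph V E} (D : Orientation G) (r α : ℝ) (f : E(G) → ℝ) :
    Prop where
  mem_Icc : ∀ e, f e ∈ Set.Icc 1 (r - 1)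
  abs_excess_le : ∀ x ∈ V(G), |(∑ᶠ e ∈ D.outEdges x, f e) - ∑ᶠ e ∈ D.inEdges x, f e| ≤ α

/-- The graph `G` admits an `(r, α)`-flow, where `p = (r, α)`, in some orientation. -/
def Admits {V E : Type} (G : Graph V E) (p : ℝ × ℝ) : Prop :=
  ∃ (D : Orientation G) (f : E(G) → ℝ), IsFlow D p.1 p.2 f

/-- The points `(r, α)` of the `r`-`α` plane: `r ≥ 2` and `α ≥ 0`. -/
def plane : Set (ℝ × ℝ) := {p | 2 ≤ p.1 ∧ 0 ≤ p.2}

/-- `p ≼ q`: every cubic graph that admits a `p`-flow also admits a `q`-flow. Vertices and edges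
range over arbitrary types in the lowest universe, which covers all finite graphs up to
isomorphism. -/
def StrongerOrEquiv (p q : ℝ × ℝ) : Prop :=
  ∀ (V E : Type) (G : Graph V E), IsCubic G → Admits G p → Admits G q

/-- `p` and `q` are equivalent: the same cubic graphs admit `p`-flows and `q`-flows. -/
def Equivalent (p q : ℝ × ℝ) : Prop := StrongerOrEquiv p q ∧ StrongerOrEquiv q p

end BoundedExcess

namespace BoundedExcess

open scoped Graph

/-! With `R = r - 1`, an `(r, 0)`-flow is a signed real flow with absolute values in `[1, R]`. Such
values stay at distance at least `1` from every multiple of `R + 1`, so flow through a gadget is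
best measured modulo `R + 1`. For `3 ≤ R < 4`, the Petersen graph minus two adjacent vertices
transmits only amounts within `R - 3` of a multiple of `R + 1` (`confined_petersen`), and it does
transmit all of `[0, R - 3]` (`carries_petersen`). So for `R₁ < R₂` it is confined to a radius `a₁`
under `R₁`, but carries amounts up to some `a₂ > a₁` under `R₂`.

This gap is amplified. Let `N + 1` be the least number of parallel copies that carries `1` under
`R₂`; the radius under `R₁` becomes `(N + 1) * a₁`. If that is below `1`, joining the two sides by
an edge gives a graph with a flow for `R₂` only. Otherwise `refine` lowers both `(N + 1) * a₁` and
`(N + 1) * a₂` by `1`: two flows of size at least `1` are forced to have opposite signs modulo `R +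
1`, so they nearly cancel. The result is again a gadget with both parameters below `1`, and the gap
has been multiplied by `N + 1 ≥ 2`. Hence the process stops (`exists_separating_of_gadget`). -/

/-- A cubic multipole with dangling edges indexed by `ι`: each of the three half-edges at a vertex
is either a dangling edge or one of the two halves of an edge. -/
structure Pole (ι : Type) where
  V : Type
  E : Type
  [fintypeV : Fintype V]
  [fintypeE : Fintype E]
  attach : V × Fin 3 ≃ ι ⊕ E × Bool

attribute [instance] Pole.fintypeV Pole.fintypeE

/-- The flow leaving a vertex along a half-edge, for the values `b` on the dangling edges and
`f` on the edges. -/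
def halfEdgeValue {ι E : Type} (b : ι → ℝ) (f : E → ℝ) : ι ⊕ E × Bool → ℝ
  | .inl i => b i
  | .inr (e, true) => f e
  | .inr (e, false) => -f e

/-! ### Flows in multipoles, disjoint unions and gluing -/

namespace Pole

variable {ι κ : Type}

/-- Flows in a pole with absolute values in `[1, R]`; `b i` is the outflow through the dangling
edge `i`. -/
structure IsFlow (P : Pole ι) (R : ℝ) (b : ι → ℝ) (f : P.E → ℝ) : Prop where
  terminal : ∀ i, |b i| ∈ Set.Icc 1 R
  edge : ∀ e, |f e| ∈ Set.Icc 1 R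
  conserve : ∀ v, ∑ j, halfEdgeValue b f (P.attach (v, j)) = 0

/-- The boundary values of flows in a pole. -/
def flows (P : Pole ι) (R : ℝ) : Set (ι → ℝ) := {b | ∃ f, P.IsFlow R b f}

lemma neg_mem_flows {P : Pole ι} {R : ℝ} {b : ι → ℝ} (hb : b ∈ P.flows R) : -b ∈ P.flows R := by
  obtain ⟨f, hf⟩ := hb
  refine ⟨-f, by simpa using hf.terminal, by simpa using hf.edge, fun v ↦ ?_⟩
  have key : ∀ x, halfEdgeValue (-b) (-f) x = -halfEdgeValue b f x := by
    rintro (i | ⟨e, _ | _⟩) <;> simp [halfEdgeValue]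
  simp [key, hf.conserve v]

/-- The pole without vertices. -/
def empty : Pole Empty where
  V := Empty
  E := Empty
  attach := Equiv.equivOfIsEmpty _ _

lemma mem_flows_empty (R : ℝ) (b : Empty → ℝ) : b ∈ empty.flows R :=
  ⟨fun e ↦ e.elim, fun e ↦ e.elim, fun e ↦ e.elim, fun v ↦ v.elim⟩

/-- The disjoint union of two poles. -/
def sum (P : Pole ι) (Q : Pole κ) : Pole (ι ⊕ κ) where
  V := P.V ⊕ Q.V
  E := P.E ⊕ Q.E
  attach := (Equiv.sumProdDistrib _ _ _).trans <| (Equiv.sumCongr P.attach Q.attach).trans <|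
    (Equiv.sumSumSumComm _ _ _ _).trans <|
      Equiv.sumCongr (Equiv.refl _) (Equiv.sumProdDistrib _ _ _).symm

lemma mem_flows_sum {P : Pole ι} {Q : Pole κ} {R : ℝ} {b : ι ⊕ κ → ℝ} :
    b ∈ (P.sum Q).flows R ↔ b ∘ Sum.inl ∈ P.flows R ∧ b ∘ Sum.inr ∈ Q.flows R := by
  have left (f : P.E ⊕ Q.E → ℝ) (v : P.V) (j : Fin 3) :
      halfEdgeValue b f ((P.sum Q).attach (Sum.inl v, j)) =
        halfEdgeValue (b ∘ Sum.inl) (f ∘ Sum.inl) (P.attach (v, j)) := by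
    change halfEdgeValue b f (Sum.map _ _ (Equiv.sumSumSumComm _ _ _ _
      (Sum.inl (P.attach (v, j))))) = _
    rcases P.attach (v, j) with i | ⟨e, _ | _⟩ <;> rfl
  have right (f : P.E ⊕ Q.E → ℝ) (v : Q.V) (j : Fin 3) :
      halfEdgeValue b f ((P.sum Q).attach (Sum.inr v, j)) =
        halfEdgeValue (b ∘ Sum.inr) (f ∘ Sum.inr) (Q.attach (v, j)) := by
    change halfEdgeValue b f (Sum.map _ _ (Equiv.sumSumSumComm _ _ _ _
      (Sum.inr (Q.attach (v, j))))) = _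
    rcases Q.attach (v, j) with i | ⟨e, _ | _⟩ <;> rfl
  constructor
  · rintro ⟨f, hf⟩
    exact ⟨⟨f ∘ Sum.inl, fun i ↦ hf.terminal _, fun e ↦ hf.edge (Sum.inl e),
      fun v ↦ (Fintype.sum_congr _ _ fun j ↦ (left f v j).symm).trans (hf.conserve (.inl v))⟩,
      ⟨f ∘ Sum.inr, fun i ↦ hf.terminal _, fun e ↦ hf.edge (Sum.inr e),
      fun v ↦ (Fintype.sum_congr _ _ fun j ↦ (right f v j).symm).trans (hf.conserve (.inr v))⟩⟩
  · rintro ⟨⟨f, hf⟩, ⟨g, hg⟩⟩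
    refine ⟨Sum.elim f g, ?_, ?_, ?_⟩
    · rintro (i | i)
      exacts [hf.terminal i, hg.terminal i]
    · rintro (i | i)
      exacts [hf.edge i, hg.edge i]
    · rintro (v | v)
      · exact (Fintype.sum_congr _ _ fun j ↦ left _ v j).trans (hf.conserve v)
      · exact (Fintype.sum_congr _ _ fun j ↦ right _ v j).trans (hg.conserve v)

/-- Add new vertices `W` to a pole, and join the dangling edges and the half-edges at the new
vertices into new edges `K` and new dangling edges `κ`. -/
def glue (P : Pole ι) {W K : Type} [Fintype W] [Fintype K]
    (e : ι ⊕ W × Fin 3 ≃ κ ⊕ K × Bool) : Pole κ where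
  V := P.V ⊕ W
  E := K ⊕ P.E
  attach := (Equiv.sumProdDistrib _ _ _).trans <|
    (Equiv.sumCongr P.attach (Equiv.refl _)).trans <|
    (Equiv.sumAssoc _ _ _).trans <|
    (Equiv.sumCongr (Equiv.refl _) (Equiv.sumComm _ _)).trans <|
    (Equiv.sumAssoc _ _ _).symm.trans <|
    (Equiv.sumCongr e (Equiv.refl _)).trans <|
    (Equiv.sumAssoc _ _ _).trans <|
      Equiv.sumCongr (Equiv.refl _) (Equiv.sumProdDistrib _ _ _).symm

lemma mem_flows_glue {P : Pole ι} {W K : Type} [Fintype W] [Fintype K]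
    {e : ι ⊕ W × Fin 3 ≃ κ ⊕ K × Bool} {R : ℝ} {b : κ → ℝ} :
    b ∈ (P.glue e).flows R ↔ ∃ g : K → ℝ, (∀ i, |b i| ∈ Set.Icc 1 R) ∧
      (∀ k, |g k| ∈ Set.Icc 1 R) ∧
      (∀ w, ∑ j, halfEdgeValue b g (e (.inr (w, j))) = 0) ∧
      (fun i ↦ halfEdgeValue b g (e (.inl i))) ∈ P.flows R := by
  have old (f : K ⊕ P.E → ℝ) (v : P.V) (j : Fin 3) :
      halfEdgeValue b f ((P.glue e).attach (Sum.inl v, j)) =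
        halfEdgeValue (fun i ↦ halfEdgeValue b (f ∘ Sum.inl) (e (.inl i))) (f ∘ Sum.inr)
          (P.attach (v, j)) := by
    -- Unfolding the equivalences only up to the attachment in `P` lets each case of the split below
    -- reduce.
    change halfEdgeValue b f (Sum.map _ _ (Equiv.sumAssoc _ _ _ (Sum.map e _
      ((Equiv.sumAssoc _ _ _).symm (Sum.map _ (Equiv.sumComm _ _)
        (Equiv.sumAssoc _ _ _ (Sum.inl (P.attach (v, j))))))))) = _
    rcases P.attach (v, j) with i | ⟨k, _ | _⟩
    · change halfEdgeValue b f (Sum.map _ _ (Equiv.sumAssoc _ _ _ (Sum.inl (e (.inl i))))) =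
        halfEdgeValue b (f ∘ Sum.inl) (e (.inl i))
      rcases e (.inl i) with i | ⟨k, _ | _⟩ <;> rfl
    · rfl
    · rfl
  have new (f : K ⊕ P.E → ℝ) (w : W) (j : Fin 3) :
      halfEdgeValue b f ((P.glue e).attach (Sum.inr w, j)) =
        halfEdgeValue b (f ∘ Sum.inl) (e (.inr (w, j))) := by
    change halfEdgeValue b f (Sum.map _ _ (Equiv.sumAssoc _ _ _ (Sum.inl (e (.inr (w, j)))))) = _
    rcases e (.inr (w, j)) with i | ⟨k, _ | _⟩ <;> rfl
  constructor
  · rintro ⟨f, hf⟩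
    have oldBounds (i : ι) : |halfEdgeValue b (f ∘ Sum.inl) (e (.inl i))| ∈ Set.Icc 1 R := by
      rcases e (.inl i) with i | ⟨k, _ | _⟩
      · exact hf.terminal i
      · exact (abs_neg (f (.inl k))).symm ▸ hf.edge (.inl k)
      · exact hf.edge (.inl k)
    exact ⟨f ∘ Sum.inl, hf.terminal, fun k ↦ hf.edge (.inl k),
      fun w ↦ (Fintype.sum_congr _ _ fun j ↦ (new f w j).symm).trans (hf.conserve (.inr w)),
      f ∘ Sum.inr, oldBounds, fun k ↦ hf.edge (.inr k),
      fun v ↦ (Fintype.sum_congr _ _ fun j ↦ (old f v j).symm).trans (hf.conserve (.inl v))⟩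
  · rintro ⟨g, hb, hg, hw, f, hf⟩
    refine ⟨Sum.elim g f, hb, ?_, ?_⟩
    · rintro (k | k)
      exacts [hg k, hf.edge k]
    · rintro (v | w)
      · exact (Fintype.sum_congr _ _ fun j ↦ old _ v j).trans (hf.conserve v)
      · exact (Fintype.sum_congr _ _ fun j ↦ new _ w j).trans (hw w)

end Pole

/-! ### Sign patterns on the 5-edge cuts of the Petersen graph -/

/-- Two or three of the five signs are positive. -/
abbrev Balanced (a b c d e : Bool) : Prop :=
  2 ≤ a.toNat + b.toNat + c.toNat + d.toNat + e.toNat ∧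
    a.toNat + b.toNat + c.toNat + d.toNat + e.toNat ≤ 3

/-- At most one of the four signs is positive. -/
abbrev AtMostOne (a b c d : Bool) : Prop := a.toNat + b.toNat + c.toNat + d.toNat ≤ 1

set_option maxRecDepth 100000 in
set_option synthInstance.maxHeartbeats 1000000 in
set_option synthInstance.maxSize 10000 in
/-- In the Petersen graph with one edge directed, no orientation of the other edges has at least
two edges in each direction across every cut around a path with three vertices. -/
lemma petersen_signs :
        ∀ t2 k6 k4 k7 : Bool, Balanced true t2 (!k6) k4 k7 →
        ∀ k5 t3 k0 : Bool, Balanced true t3 (!k0) k5 (!k7) →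
        ∀ k9 : Bool, Balanced t2 k0 (!k5) (!k4) k9 →
        ∀ k2 : Bool, Balanced true (!k0) (!k2) (!k6) k9 → Balanced (!t3) (!k6) k2 k5 k4 →
        ∀ k1 k8 : Bool, Balanced true (!k1) k4 k5 (!k8) → Balanced t2 k2 k1 (!k6) k8 → Balanced
      (!k0) k1 t3 (!k9) k8 →
        ∀ t0 : Bool, Balanced t0 t2 t3 (!k5) k8 → Balanced true (!t0) (!k8) (!k2) k7 → Balanced
      (!k0) t0 k4 (!k6) k8 → Balanced (!k1) t0 t3 k6 (!k7) → Balanced k1 (!t0) k2 k5 (!k9) →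
        ∀ k3 : Bool, Balanced true (!t0) k5 (!k3) (!k6) → Balanced true t3 (!k2) (!k1) (!k3) →
      Balanced true t2 k9 k3 (!k8) → Balanced t2 k2 k3 t0 k4 → Balanced t2 k1 k3 (!k5) k7 →
      Balanced (!k0) k3 t0 (!k7) k9 → Balanced (!t3) k3 (!k8) k4 k7 →
        ∀ t1 : Bool, Balanced t0 t1 t3 (!k0) (!k2) → Balanced t1 t2 t3 k1 (!k4) → Balanced t0 t1
      t2 (!k6) k9 → Balanced true (!t1) (!k0) k3 k4 → Balanced true (!t1) (!k1) (!k7) k9 →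
      Balanced t2 k0 t1 (!k8) k7 → Balanced (!k0) k1 t1 k5 (!k6) → Balanced t1 k5 t3 (!k9) (!k3) →
      Balanced (!t1) k2 (!k7) k3 k6 → Balanced (!t1) k8 k2 k4 (!k9) → False := by
    -- Each constraint in the statement comes as soon as its signs are quantified, so the evaluation
    -- prunes like a backtracking search.
    decide

set_option maxRecDepth 100000 in
set_option synthInstance.maxHeartbeats 1000000 in
set_option synthInstance.maxSize 10000 in
/-- In the Petersen graph with one edge directed, no orientation of the other edges has at least
two edges in each direction across every cut around a path with three vertices, and at least
three edges against the directed one if that edge is in the cut. -/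
lemma petersen_signs_large :
        ∀ k5 k3 k6 t0 : Bool, AtMostOne (!t0) k5 (!k3) (!k6) →
        ∀ k4 t1 k0 : Bool, AtMostOne (!t1) (!k0) k3 k4 →
        ∀ k8 : Bool, Balanced (!k0) t0 k4 (!k6) k8 →
        ∀ k1 : Bool, AtMostOne (!k1) k4 k5 (!k8) → Balanced (!k0) k1 t1 k5 (!k6) →
        ∀ t3 k2 : Bool, AtMostOne t3 (!k2) (!k1) (!k3) → Balanced (!t3) (!k6) k2 k5 k4 →
        ∀ k9 : Bool, AtMostOne (!k0) (!k2) (!k6) k9 → Balanced (!k0) k1 t3 (!k9) k8 → Balanced k1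
      (!t0) k2 k5 (!k9) → Balanced (!t1) k8 k2 k4 (!k9) →
        ∀ k7 : Bool, AtMostOne (!t1) (!k1) (!k7) k9 → AtMostOne (!t0) (!k8) (!k2) k7 → AtMostOne
      t3 (!k0) k5 (!k7) → Balanced (!k0) k3 t0 (!k7) k9 → Balanced (!t1) k2 (!k7) k3 k6 → Balanced
      (!t3) k3 (!k8) k4 k7 →
        ∀ t2 : Bool, AtMostOne t2 k9 k3 (!k8) → AtMostOne t2 (!k6) k4 k7 → Balanced t2 k1 k3 (!k5)
      k7 → Balanced t2 k2 k1 (!k6) k8 → Balanced t2 k0 (!k5) (!k4) k9 → False := by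
    decide

/-- The number `x` has absolute value in `[1, R]` and the sign `p`. -/
def HasSign (R : ℝ) (p : Bool) (x : ℝ) : Prop :=
  cond p (1 ≤ x ∧ x ≤ R) (1 ≤ -x ∧ -x ≤ R)

lemma HasSign.neg {R x : ℝ} {p : Bool} (h : HasSign R p x) : HasSign R (!p) (-x) := by
  cases p <;> simpa [HasSign] using h

lemma exists_hasSign {R x : ℝ} (h : |x| ∈ Set.Icc 1 R) : ∃ p, HasSign R p x := by
  rcases le_total 0 x with hx | hx
  · exact ⟨true, by simpa [HasSign, abs_of_nonneg hx] using h⟩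
  · exact ⟨false, by simpa [HasSign, abs_of_nonpos hx] using h⟩

/-- Four values of one sign total at least `4 > R`, more than a single opposite value can cancel. -/
lemma HasSign.balanced {R a b c d e : ℝ} {p q r s t : Bool} (hR : R < 4)
    (ha : HasSign R p a) (hb : HasSign R q b) (hc : HasSign R r c) (hd : HasSign R s d)
    (he : HasSign R t e) (h : a + b + c + d + e = 0) : Balanced p q r s t := by
  cases p <;> cases q <;> cases r <;> cases s <;> cases t <;>
    simp only [HasSign, cond_true, cond_false] at ha hb hc hd he <;>
    first
    | (exfalso; linarith)
    | (constructor <;> decide)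

/-- One opposite value cannot cancel `x + 3 > R`, and `x < 4` alone cannot cancel four opposite
values. -/
lemma HasSign.balanced_true {R x a b c d : ℝ} {q r s t : Bool} (hx : R - 3 < x) (hx0 : 0 < x)
    (hx4 : x < 4) (ha : HasSign R q a) (hb : HasSign R r b) (hc : HasSign R s c)
    (hd : HasSign R t d) (h : x + a + b + c + d = 0) : Balanced true q r s t := by
  cases q <;> cases r <;> cases s <;> cases t <;>
    simp only [HasSign, cond_true, cond_false] at ha hb hc hd <;>
    first
    | (exfalso; linarith)
    | (constructor <;> decide)

/-- With two further positive values the positive side exceeds `2 * R`, too much for the two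
remaining edges. -/
lemma HasSign.atMostOne {R x a b c d : ℝ} {q r s t : Bool} (hx : 2 * R - 2 < x) (hR : 3 ≤ R)
    (ha : HasSign R q a) (hb : HasSign R r b) (hc : HasSign R s c)
    (hd : HasSign R t d) (h : x + a + b + c + d = 0) : AtMostOne q r s t := by
  cases q <;> cases r <;> cases s <;> cases t <;>
    simp only [HasSign, cond_true, cond_false] at ha hb hc hd <;>
    first
    | (exfalso; linarith)
    | decide

/-- If the edges of the Petersen graph other than one edge `uv` carry a flow with absolute values
in `[1, R]`, where `3 ≤ R < 4`, and `uv` carries `x ≥ 0`, then `x` is within `R - 3` of a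
multiple of `R + 1`. -/
lemma petersen_flow {R : ℝ} (hR3 : 3 ≤ R) (hR4 : R < 4)
    {x t0 t1 t2 t3 k0 k1 k2 k3 k4 k5 k6 k7 k8 k9 : ℝ} (hx : 0 ≤ x)
    (ht0 : |t0| ∈ Set.Icc 1 R) (ht1 : |t1| ∈ Set.Icc 1 R) (ht2 : |t2| ∈ Set.Icc 1 R)
    (ht3 : |t3| ∈ Set.Icc 1 R) (hk0 : |k0| ∈ Set.Icc 1 R) (hk1 : |k1| ∈ Set.Icc 1 R)
    (hk2 : |k2| ∈ Set.Icc 1 R) (hk3 : |k3| ∈ Set.Icc 1 R) (hk4 : |k4| ∈ Set.Icc 1 R)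
    (hk5 : |k5| ∈ Set.Icc 1 R) (hk6 : |k6| ∈ Set.Icc 1 R) (hk7 : |k7| ∈ Set.Icc 1 R)
    (hk8 : |k8| ∈ Set.Icc 1 R) (hk9 : |k9| ∈ Set.Icc 1 R)
    (e0 : x - t0 - t1 = 0) (e1 : -x - t2 - t3 = 0)
    (e2 : t2 + k0 + k2 = 0) (e3 : -k0 + k1 + k3 = 0) (e4 : -k1 + t0 + k4 = 0)
    (e5 : t1 + k5 - k8 = 0) (e6 : t3 + k6 - k9 = 0) (e7 : -k2 - k5 + k7 = 0)
    (e8 : -k3 - k6 + k8 = 0) :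
    ∃ n : ℤ, |x - n * (R + 1)| ≤ R - 3 := by
  replace ⟨_, ht0⟩ := exists_hasSign ht0
  replace ⟨_, ht1⟩ := exists_hasSign ht1
  replace ⟨_, ht2⟩ := exists_hasSign ht2
  replace ⟨_, ht3⟩ := exists_hasSign ht3
  replace ⟨_, hk0⟩ := exists_hasSign hk0
  replace ⟨_, hk1⟩ := exists_hasSign hk1
  replace ⟨_, hk2⟩ := exists_hasSign hk2
  replace ⟨_, hk3⟩ := exists_hasSign hk3
  replace ⟨_, hk4⟩ := exists_hasSign hk4
  replace ⟨_, hk5⟩ := exists_hasSign hk5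
  replace ⟨_, hk6⟩ := exists_hasSign hk6
  replace ⟨_, hk7⟩ := exists_hasSign hk7
  replace ⟨_, hk8⟩ := exists_hasSign hk8
  replace ⟨_, hk9⟩ := exists_hasSign hk9
  have cut {a b c d e : ℝ} {p q r s t : Bool} (ha : HasSign R p a) (hb : HasSign R q b)
      (hc : HasSign R r c) (hd : HasSign R s d) (he : HasSign R t e) :=
    HasSign.balanced hR4 ha hb hc hd he
  rcases le_or_gt x (R - 3) with h1 | h1
  · exact ⟨0, by simpa [abs_of_nonneg hx] using h1⟩
  rcases lt_or_ge x 4 with h2 | h2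
  · exfalso
    have cx {a b c d : ℝ} {q r s t : Bool} (ha : HasSign R q a) (hb : HasSign R r b)
        (hc : HasSign R s c) (hd : HasSign R t d) :=
      HasSign.balanced_true h1 (by linarith) h2 ha hb hc hd
    exact petersen_signs _ _ _ _ (cx ht2 hk6.neg hk4 hk7 (by linarith)) _ _ _
      (cx ht3 hk0.neg hk5 hk7.neg (by linarith)) _ (cut ht2 hk0 hk5.neg hk4.neg hk9 (by linarith)) _
      (cx hk0.neg hk2.neg hk6.neg hk9 (by linarith)) (cut ht3.neg hk6.neg hk2 hk5 hk4 (by linarith))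
      _ _ (cx hk1.neg hk4 hk5 hk8.neg (by linarith)) (cut ht2 hk2 hk1 hk6.neg hk8 (by linarith))
      (cut hk0.neg hk1 ht3 hk9.neg hk8 (by linarith)) _ (cut ht0 ht2 ht3 hk5.neg hk8 (by linarith))
      (cx ht0.neg hk8.neg hk2.neg hk7 (by linarith)) (cut hk0.neg ht0 hk4 hk6.neg hk8 (by linarith))
      (cut hk1.neg ht0 ht3 hk6 hk7.neg (by linarith))
      (cut hk1 ht0.neg hk2 hk5 hk9.neg (by linarith)) _
      (cx ht0.neg hk5 hk3.neg hk6.neg (by linarith)) (cx ht3 hk2.neg hk1.neg hk3.neg (by linarith))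
      (cx ht2 hk9 hk3 hk8.neg (by linarith)) (cut ht2 hk2 hk3 ht0 hk4 (by linarith))
      (cut ht2 hk1 hk3 hk5.neg hk7 (by linarith)) (cut hk0.neg hk3 ht0 hk7.neg hk9 (by linarith))
      (cut ht3.neg hk3 hk8.neg hk4 hk7 (by linarith)) _
      (cut ht0 ht1 ht3 hk0.neg hk2.neg (by linarith)) (cut ht1 ht2 ht3 hk1 hk4.neg (by linarith))
      (cut ht0 ht1 ht2 hk6.neg hk9 (by linarith)) (cx ht1.neg hk0.neg hk3 hk4 (by linarith))
      (cx ht1.neg hk1.neg hk7.neg hk9 (by linarith)) (cut ht2 hk0 ht1 hk8.neg hk7 (by linarith))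
      (cut hk0.neg hk1 ht1 hk5 hk6.neg (by linarith))
      (cut ht1 hk5 ht3 hk9.neg hk3.neg (by linarith))
      (cut ht1.neg hk2 hk7.neg hk3 hk6 (by linarith))
      (cut ht1.neg hk8 hk2 hk4 hk9.neg (by linarith))
  rcases le_or_gt x (2 * R - 2) with h3 | h3
  -- The interval `[4, 2 * R - 2]` has centre `R + 1` and radius `R - 3`.
  · exact ⟨1, by rw [abs_le]; push_cast; constructor <;> linarith⟩
  · exfalso
    have cx {a b c d : ℝ} {q r s t : Bool} (ha : HasSign R q a) (hb : HasSign R r b)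
        (hc : HasSign R s c) (hd : HasSign R t d) :=
      HasSign.atMostOne h3 hR3 ha hb hc hd
    exact petersen_signs_large _ _ _ _ (cx ht0.neg hk5 hk3.neg hk6.neg (by linarith)) _ _ _
      (cx ht1.neg hk0.neg hk3 hk4 (by linarith)) _ (cut hk0.neg ht0 hk4 hk6.neg hk8 (by linarith)) _
      (cx hk1.neg hk4 hk5 hk8.neg (by linarith)) (cut hk0.neg hk1 ht1 hk5 hk6.neg (by linarith)) _ _
      (cx ht3 hk2.neg hk1.neg hk3.neg (by linarith)) (cut ht3.neg hk6.neg hk2 hk5 hk4 (by linarith))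
      _ (cx hk0.neg hk2.neg hk6.neg hk9 (by linarith))
      (cut hk0.neg hk1 ht3 hk9.neg hk8 (by linarith))
      (cut hk1 ht0.neg hk2 hk5 hk9.neg (by linarith))
      (cut ht1.neg hk8 hk2 hk4 hk9.neg (by linarith)) _
      (cx ht1.neg hk1.neg hk7.neg hk9 (by linarith)) (cx ht0.neg hk8.neg hk2.neg hk7 (by linarith))
      (cx ht3 hk0.neg hk5 hk7.neg (by linarith)) (cut hk0.neg hk3 ht0 hk7.neg hk9 (by linarith))
      (cut ht1.neg hk2 hk7.neg hk3 hk6 (by linarith))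
      (cut ht3.neg hk3 hk8.neg hk4 hk7 (by linarith)) _ (cx ht2 hk9 hk3 hk8.neg (by linarith))
      (cx ht2 hk6.neg hk4 hk7 (by linarith)) (cut ht2 hk1 hk3 hk5.neg hk7 (by linarith))
      (cut ht2 hk2 hk1 hk6.neg hk8 (by linarith)) (cut ht2 hk0 hk5.neg hk4.neg hk9 (by linarith))

/-! ### The Petersen gadget and its parallel and series compositions -/

namespace Pole

/-- The half-edges of the Petersen graph without two adjacent vertices. -/
def petersenTable : Empty ⊕ Fin 8 × Fin 3 → Fin 4 ⊕ Fin 10 × Bool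
  | .inr (w, j) =>
    (![![.inl 2, .inr (0, true), .inr (2, true)],
      ![.inr (0, false), .inr (1, true), .inr (3, true)],
      ![.inr (1, false), .inl 0, .inr (4, true)],
      ![.inl 1, .inr (5, true), .inr (8, false)],
      ![.inl 3, .inr (6, true), .inr (9, false)],
      ![.inr (2, false), .inr (5, false), .inr (7, true)],
      ![.inr (3, false), .inr (6, false), .inr (8, true)],
      ![.inr (4, false), .inr (7, false), .inr (9, true)]] :
      Fin 8 → Fin 3 → Fin 4 ⊕ Fin 10 × Bool) w j

set_option maxRecDepth 100000 in
lemma petersenTable_bijective : Function.Bijective petersenTable := by decide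

/-- The Petersen graph without two adjacent vertices: the dangling edges `0`, `1` come from one of
the removed vertices, and `2`, `3` from the other. -/
noncomputable def petersen : Pole (Fin 4) :=
  empty.glue (Equiv.ofBijective petersenTable petersenTable_bijective)

lemma mem_flows_petersen {R : ℝ} {b : Fin 4 → ℝ} :
    b ∈ petersen.flows R ↔ ∃ k : Fin 10 → ℝ, (∀ i, |b i| ∈ Set.Icc 1 R) ∧
      (∀ i, |k i| ∈ Set.Icc 1 R) ∧
      b 2 + k 0 + k 2 = 0 ∧ -k 0 + k 1 + k 3 = 0 ∧ -k 1 + b 0 + k 4 = 0 ∧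
      b 1 + k 5 - k 8 = 0 ∧ b 3 + k 6 - k 9 = 0 ∧ -k 2 - k 5 + k 7 = 0 ∧
      -k 3 - k 6 + k 8 = 0 ∧ -k 4 - k 7 + k 9 = 0 := by
  simp only [petersen, mem_flows_glue, mem_flows_empty, Fin.forall_fin_succ, Fin.sum_univ_three]
  simp [petersenTable, halfEdgeValue, sub_eq_add_neg]

/-- The half-edges at the four vertices that add a gadget to a chain, see `chain`. -/
def chainTable : (Fin 4 ⊕ Fin 4) ⊕ Fin 4 × Fin 3 → Fin 4 ⊕ Fin 8 × Bool
  | .inl (.inl i) => (![.inr (0, true), .inl 1, .inr (4, true), .inl 3] :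
      Fin 4 → Fin 4 ⊕ Fin 8 × Bool) i
  | .inl (.inr i) => (![.inr (1, true), .inr (3, true), .inr (5, true), .inr (7, true)] :
      Fin 4 → Fin 4 ⊕ Fin 8 × Bool) i
  | .inr (w, j) =>
    (![![.inr (0, false), .inr (1, false), .inr (2, true)],
      ![.inr (2, false), .inr (3, false), .inl 0],
      ![.inr (4, false), .inr (5, false), .inr (6, true)],
      ![.inr (6, false), .inr (7, false), .inl 2]] :
      Fin 4 → Fin 3 → Fin 4 ⊕ Fin 8 × Bool) w j

set_option maxRecDepth 100000 in
lemma chainTable_bijective : Function.Bijective chainTable := by decide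

/-- On both sides, the dangling edge `0` of `P` is merged with the two dangling edges of `Q`. -/
noncomputable def chain (P Q : Pole (Fin 4)) : Pole (Fin 4) :=
  (P.sum Q).glue (Equiv.ofBijective chainTable chainTable_bijective)

/-- Edges leaving a gadget have their `true` half there, so `g` gives the gadget's boundary values
unsigned and enters with a minus sign at the new vertices. The same convention is used in `refine`
and `close`. -/
lemma mem_flows_chain {P Q : Pole (Fin 4)} {R : ℝ} {b : Fin 4 → ℝ} :
    b ∈ (P.chain Q).flows R ↔ ∃ g : Fin 8 → ℝ, (∀ i, |b i| ∈ Set.Icc 1 R) ∧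
      (∀ i, |g i| ∈ Set.Icc 1 R) ∧
      (-g 0 - g 1 + g 2 = 0 ∧ -g 2 - g 3 + b 0 = 0 ∧
        -g 4 - g 5 + g 6 = 0 ∧ -g 6 - g 7 + b 2 = 0) ∧
      ![g 0, b 1, g 4, b 3] ∈ P.flows R ∧ ![g 1, g 3, g 5, g 7] ∈ Q.flows R := by
  simp only [chain, mem_flows_glue, mem_flows_sum]
  refine exists_congr fun g ↦ and_congr_right fun _ ↦ and_congr_right fun _ ↦ and_congr ?_ ?_
  · simp only [Fin.forall_fin_succ, Fin.sum_univ_three]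
    simp [chainTable, halfEdgeValue, sub_eq_add_neg]
  · refine iff_of_eq (congrArg₂ _ (congrArg₂ _ rfl ?_) (congrArg₂ _ rfl ?_)) <;>
      exact funext fun i ↦ by fin_cases i <;> rfl

/-- The half-edges at the four vertices that join three gadgets, see `refine`. -/
def refineTable : ((Fin 4 ⊕ Fin 4) ⊕ Fin 4) ⊕ Fin 4 × Fin 3 → Fin 4 ⊕ Fin 10 × Bool
  | .inl (.inl (.inl i)) => (![.inr (0, true), .inr (1, true), .inr (2, true), .inr (3, true)] :
      Fin 4 → Fin 4 ⊕ Fin 10 × Bool) i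
  | .inl (.inl (.inr i)) => (![.inr (4, true), .inr (5, true), .inr (6, true), .inr (7, true)] :
      Fin 4 → Fin 4 ⊕ Fin 10 × Bool) i
  | .inl (.inr i) => (![.inr (8, true), .inr (9, true), .inl 2, .inl 3] :
      Fin 4 → Fin 4 ⊕ Fin 10 × Bool) i
  | .inr (w, j) =>
    (![![.inr (0, false), .inr (1, false), .inl 0],
      ![.inr (4, false), .inr (5, false), .inl 1],
      ![.inr (2, false), .inr (3, false), .inr (8, false)],
      ![.inr (6, false), .inr (7, false), .inr (9, false)]] :
      Fin 4 → Fin 3 → Fin 4 ⊕ Fin 10 × Bool) w j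

set_option maxRecDepth 100000 in
lemma refineTable_bijective : Function.Bijective refineTable := by decide

/-- Two copies of `P`, with the dangling edges on each side merged into one, are placed in
parallel, and the result is in series with `Q`. -/
noncomputable def refine (P Q : Pole (Fin 4)) : Pole (Fin 4) :=
  ((P.sum P).sum Q).glue (Equiv.ofBijective refineTable refineTable_bijective)

lemma mem_flows_refine {P Q : Pole (Fin 4)} {R : ℝ} {b : Fin 4 → ℝ} :
    b ∈ (P.refine Q).flows R ↔ ∃ g : Fin 10 → ℝ, (∀ i, |b i| ∈ Set.Icc 1 R) ∧
      (∀ i, |g i| ∈ Set.Icc 1 R) ∧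
      (-g 0 - g 1 + b 0 = 0 ∧ -g 4 - g 5 + b 1 = 0 ∧
        -g 2 - g 3 - g 8 = 0 ∧ -g 6 - g 7 - g 9 = 0) ∧
      (![g 0, g 1, g 2, g 3] ∈ P.flows R ∧ ![g 4, g 5, g 6, g 7] ∈ P.flows R) ∧
        ![g 8, g 9, b 2, b 3] ∈ Q.flows R := by
  simp only [refine, mem_flows_glue, mem_flows_sum]
  refine exists_congr fun g ↦ and_congr_right fun _ ↦ and_congr_right fun _ ↦ and_congr ?_ ?_
  · simp only [Fin.forall_fin_succ, Fin.sum_univ_three]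
    simp [refineTable, halfEdgeValue, sub_eq_add_neg]
  · refine iff_of_eq (congrArg₂ _ (congrArg₂ _ (congrArg₂ _ rfl ?_) (congrArg₂ _ rfl ?_))
      (congrArg₂ _ rfl ?_)) <;>
      exact funext fun i ↦ by fin_cases i <;> rfl

/-- The half-edges at the two vertices that close a gadget, see `close`. -/
def closeTable : Fin 4 ⊕ Fin 2 × Fin 3 → Empty ⊕ Fin 5 × Bool
  | .inl i => (![.inr (0, true), .inr (1, true), .inr (2, true), .inr (3, true)] :
      Fin 4 → Empty ⊕ Fin 5 × Bool) i
  | .inr (w, j) =>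
    (![![.inr (0, false), .inr (1, false), .inr (4, true)],
      ![.inr (2, false), .inr (3, false), .inr (4, false)]] :
      Fin 2 → Fin 3 → Empty ⊕ Fin 5 × Bool) w j

set_option maxRecDepth 100000 in
lemma closeTable_bijective : Function.Bijective closeTable := by decide

/-- The dangling edges on each side are merged, and the two sides joined by an edge. -/
noncomputable def close (P : Pole (Fin 4)) : Pole Empty :=
  P.glue (Equiv.ofBijective closeTable closeTable_bijective)

lemma mem_flows_close {P : Pole (Fin 4)} {R : ℝ} {b : Empty → ℝ} :
    b ∈ P.close.flows R ↔ ∃ g : Fin 5 → ℝ, (∀ i, |g i| ∈ Set.Icc 1 R) ∧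
      (-g 0 - g 1 + g 4 = 0 ∧ -g 2 - g 3 - g 4 = 0) ∧
      ![g 0, g 1, g 2, g 3] ∈ P.flows R := by
  simp only [close, mem_flows_glue, IsEmpty.forall_iff, true_and]
  refine exists_congr fun g ↦ and_congr_right fun _ ↦ and_congr ?_ ?_
  · simp only [Fin.forall_fin_succ, Fin.sum_univ_three]
    simp [closeTable, halfEdgeValue, sub_eq_add_neg]
  · refine iff_of_eq (congrArg₂ _ rfl ?_)
    exact funext fun i ↦ by fin_cases i <;> rfl

/-! ### Confining and carrying flow, and the amplification of gaps -/

lemma abs_mem_of_mem_flows {ι : Type} {P : Pole ι} {R : ℝ} {b : ι → ℝ} (hb : b ∈ P.flows R)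
    (i : ι) : |b i| ∈ Set.Icc 1 R :=
  hb.choose_spec.terminal i

/-- In every flow, the outflow on one side is the inflow on the other side, and it is within `a`
of a multiple of `R + 1`. -/
def Confined (P : Pole (Fin 4)) (R a : ℝ) : Prop :=
  ∀ b ∈ P.flows R, b 2 + b 3 = -(b 0 + b 1) ∧ ∃ n : ℤ, |b 0 + b 1 - n * (R + 1)| ≤ a

/-- There is a flow with total outflow `y` on one side, in a standard form. -/
def Carries (P : Pole (Fin 4)) (R y : ℝ) : Prop := ![1 + y, -1, -(1 + y), 1] ∈ P.flows R

variable {P Q : Pole (Fin 4)} {R a a' y z : ℝ}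

lemma abs_mem_of_one_le {x : ℝ} (h1 : 1 ≤ x) (h2 : x ≤ R) : |x| ∈ Set.Icc 1 R := by
  rw [abs_of_nonneg (by linarith)]
  exact ⟨h1, h2⟩

lemma abs_mem_of_le_neg_one {x : ℝ} (h1 : x ≤ -1) (h2 : -R ≤ x) : |x| ∈ Set.Icc 1 R := by
  rw [← abs_neg]
  exact abs_mem_of_one_le (by linarith) (by linarith)

lemma confined_petersen (hR3 : 3 ≤ R) (hR4 : R < 4) : petersen.Confined R (R - 3) := by
  have key (b) (hb : b ∈ petersen.flows R) (h0 : 0 ≤ b 0 + b 1) :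
      b 2 + b 3 = -(b 0 + b 1) ∧ ∃ n : ℤ, |b 0 + b 1 - n * (R + 1)| ≤ R - 3 := by
    obtain ⟨k, hb, hk, e2, e3, e4, e5, e6, e7, e8, e9⟩ := mem_flows_petersen.1 hb
    have sides : b 2 + b 3 = -(b 0 + b 1) := by linarith
    exact ⟨sides, petersen_flow hR3 hR4 h0 (hb 0) (hb 1) (hb 2) (hb 3) (hk 0) (hk 1) (hk 2) (hk 3)
      (hk 4) (hk 5) (hk 6) (hk 7) (hk 8) (hk 9) (by ring) (by linarith) e2 e3 e4 e5 e6 e7 e8⟩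
  intro b hb
  rcases le_total 0 (b 0 + b 1) with h0 | h0
  · exact key b hb h0
  · obtain ⟨h1, n, hn⟩ := key (-b) (neg_mem_flows hb) (by simp only [Pi.neg_apply]; linarith)
    simp only [Pi.neg_apply] at h1 hn
    refine ⟨by linarith, -n, ?_⟩
    rw [← abs_neg]
    convert! hn using 2
    push_cast
    ring

lemma carries_petersen (hR3 : 3 ≤ R) (hy : 0 ≤ y) (hyR : y ≤ R - 3) : petersen.Carries R y := by
  -- The largest value is `3 + y`, which is where `y ≤ R - 3` is needed.
  refine mem_flows_petersen.2 ⟨![2 + y, 3 + y, -1, -1, 2, 2, 2, 1, 1, 3], ?_, ?_, ?_⟩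
  · intro i
    fin_cases i <;> dsimp <;>
      first
      | (apply abs_mem_of_one_le <;> linarith)
      | (apply abs_mem_of_le_neg_one <;> linarith)
  · intro i
    fin_cases i <;> dsimp <;>
      first
      | (apply abs_mem_of_one_le <;> linarith)
      | (apply abs_mem_of_le_neg_one <;> linarith)
  · refine ⟨?_, ?_, ?_, ?_, ?_, ?_, ?_, ?_⟩ <;> simp <;> ring

lemma Confined.chain (hP : P.Confined R a) (hQ : Q.Confined R a') :
    (P.chain Q).Confined R (a + a') := by
  intro b hb
  obtain ⟨g, -, -, ⟨e0, e1, e2, e3⟩, hgP, hgQ⟩ := mem_flows_chain.1 hb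
  obtain ⟨h1, n, hn⟩ := hP _ hgP
  obtain ⟨h2, m, hm⟩ := hQ _ hgQ
  simp at h1 hn h2 hm
  refine ⟨by linarith, n + m, ?_⟩
  rw [abs_le] at *
  push_cast
  constructor <;> linarith

/-- The bound `h` is for the intermediate edges, which carry `2 + (z + y)` after the first merging
on each side. -/
lemma Carries.chain (hP : P.Carries R z) (hQ : Q.Carries R y) (hz : 0 ≤ z) (hy : 0 ≤ y)
    (h : 2 + (z + y) ≤ R) : (P.chain Q).Carries R (z + y) := by
  refine mem_flows_chain.2 ⟨![1 + z, 1 + y, 2 + (z + y), -1, -(1 + z), -(1 + y), -(2 + (z + y)), 1],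
    ?_, ?_, ?_, hP, hQ⟩
  · intro i
    fin_cases i <;> dsimp <;>
      first
      | (apply abs_mem_of_one_le <;> linarith)
      | (apply abs_mem_of_le_neg_one <;> linarith)
  · intro i
    fin_cases i <;> dsimp <;>
      first
      | (apply abs_mem_of_one_le <;> linarith)
      | (apply abs_mem_of_le_neg_one <;> linarith)
  · refine ⟨?_, ?_, ?_, ?_⟩ <;> simp <;> ring

lemma exists_multiple {R₁ R₂ a₁ a₂ : ℝ} (hP : P.Confined R₁ a₁)
    (hc : ∀ y ∈ Set.Icc 0 a₂, P.Carries R₂ y) (n : ℕ) :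
    ∃ T : Pole (Fin 4), T.Confined R₁ ((n + 1 : ℕ) * a₁) ∧
      ∀ y ∈ Set.Icc 0 a₂, 2 + (n + 1 : ℕ) * y ≤ R₂ → T.Carries R₂ ((n + 1 : ℕ) * y) := by
  induction n with
  | zero => exact ⟨P, by simpa using hP, fun y hy _ ↦ by simpa using hc y hy⟩
  | succ n ih =>
    obtain ⟨T, hT, hTc⟩ := ih
    refine ⟨T.chain P, ?_, fun y hy hyR ↦ ?_⟩
    · convert! hT.chain hP using 1
      push_cast
      ring
    · have e : ((n + 1 + 1 : ℕ) : ℝ) * y = (n + 1 : ℕ) * y + y := by push_cast; ring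
      rw [e] at hyR ⊢
      exact (hTc y hy (by linarith [hy.1])).chain (hc y hy) (mul_nonneg (by positivity) hy.1) hy.1
        hyR

/-- A number with absolute value in `[1, R]` is at distance at least `1` from every multiple of
`R + 1`. -/
lemma one_le_abs_sub_mul {c : ℝ} (hc : |c| ∈ Set.Icc 1 R) (n : ℤ) : 1 ≤ |c - n * (R + 1)| := by
  have hR : 1 ≤ R := hc.1.trans hc.2
  obtain ⟨h1, h2⟩ := abs_le.1 hc.2
  rcases lt_trichotomy n 0 with hn | rfl | hn
  · have : (n : ℝ) ≤ -1 := by exact_mod_cast (show n ≤ -1 by omega)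
    rw [le_abs]; left; nlinarith
  · simpa using hc.1
  · have : (1 : ℝ) ≤ n := by exact_mod_cast hn
    rw [le_abs]; right; nlinarith

/-- Modulo `R + 1`, the outflows `b 0` and `b 1` have representatives of size in `[1, A]`, while `Q`
keeps their sum within `a < 1` of `0`. Equal signs would give a sum of size in `[2, 2 * A]`, which
`hA` excludes; for opposite signs the sum has size at most `A - 1`. -/
lemma Confined.refine {A : ℝ} (hP : P.Confined R A) (hQ : Q.Confined R a) (ha : a < 1)
    (hA : 2 * A + a < R + 1) : (P.refine Q).Confined R (A - 1) := by
  intro b hb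
  obtain ⟨g, hb, -, ⟨e0, e1, e2, e3⟩, ⟨hg, hg'⟩, hgQ⟩ := mem_flows_refine.1 hb
  obtain ⟨h1, n, hn⟩ := hP _ hg
  obtain ⟨h2, m, hm⟩ := hP _ hg'
  obtain ⟨h3, l, hl⟩ := hQ _ hgQ
  simp at h1 hn h2 hm h3 hl
  rw [show g 0 + g 1 = b 0 by linarith] at hn
  rw [show g 4 + g 5 = b 1 by linarith] at hm
  rw [show g 8 + g 9 = b 0 + b 1 by linarith] at hl
  have un := one_le_abs_sub_mul (hb 0) n
  have um := one_le_abs_sub_mul (hb 1) m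
  have hR : 1 ≤ R := (hb 0).1.trans (hb 0).2
  refine ⟨by linarith, n + m, ?_⟩
  -- No multiple of `R + 1` lies strictly between `0` and `R + 1`; this refutes equal signs.
  have same (s : ℝ) (hs : s = ((l - n - m : ℤ) : ℝ) * (R + 1)) (h0 : 0 < s) (h1 : s < R + 1) :
      False := by
    rw [hs] at h0 h1
    have h0' : (0 : ℝ) < (l - n - m : ℤ) := pos_of_mul_pos_left h0 (by linarith)
    have h0'' : (1 : ℝ) ≤ (l - n - m : ℤ) := by exact_mod_cast h0'
    nlinarith
  have same' (s : ℝ) (hs : s = ((n + m - l : ℤ) : ℝ) * (R + 1)) (h0 : 0 < s) (h1 : s < R + 1) :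
      False := by
    rw [hs] at h0 h1
    have h0' : (0 : ℝ) < (n + m - l : ℤ) := pos_of_mul_pos_left h0 (by linarith)
    have h0'' : (1 : ℝ) ≤ (n + m - l : ℤ) := by exact_mod_cast h0'
    nlinarith
  rw [abs_le] at hn hm hl ⊢
  push_cast at same same' ⊢
  rcases le_abs.1 un with un | un <;> rcases le_abs.1 um with um | um
  · exact (same (b 0 - n * (R + 1) + (b 1 - m * (R + 1)) - (b 0 + b 1 - l * (R + 1))) (by ring)
      (by linarith) (by linarith)).elim
  · constructor <;> linarith
  · constructor <;> linarith
  · exact (same' (-(b 0 - n * (R + 1) + (b 1 - m * (R + 1)) - (b 0 + b 1 - l * (R + 1)))) (by ring)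
      (by linarith) (by linarith)).elim

/-- One copy of `P` carries `1 + y` and the other carries `-1`, so `Q` carries `y`. -/
lemma Carries.refine (hP : P.Carries R (1 + y)) (hP' : P.Carries R 1) (hQ : Q.Carries R y) :
    (P.refine Q).Carries R y := by
  have p := abs_mem_of_mem_flows hP
  have p' := abs_mem_of_mem_flows hP'
  have q := abs_mem_of_mem_flows hQ
  refine mem_flows_refine.2 ⟨![1 + (1 + y), -1, -(1 + (1 + y)), 1, -(1 + 1), 1, 1 + 1, -1,
    1 + y, -1], q, ?_, ?_, ⟨hP, ?_⟩, hQ⟩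
  · intro i
    fin_cases i
    exacts [p 0, p 1, p 2, p 3, p' 2, p' 3, by rw [← abs_neg]; exact p' 2, p' 1, q 0, q 1]
  · refine ⟨?_, ?_, ?_, ?_⟩ <;> simp
  · convert! neg_mem_flows hP' using 1
    ext i
    fin_cases i <;> simp

/-- The closing edge would carry a value at distance less than `1` from a multiple of `R + 1`. -/
lemma Confined.flows_close_eq_empty (hP : P.Confined R a) (ha : a < 1) : P.close.flows R = ∅ := by
  refine Set.eq_empty_of_forall_notMem fun b hb ↦ ?_
  obtain ⟨g, hg, ⟨e0, e1⟩, hgP⟩ := mem_flows_close.1 hb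
  obtain ⟨-, n, hn⟩ := hP _ hgP
  simp at hn
  rw [show g 0 + g 1 = g 4 by linarith] at hn
  linarith [one_le_abs_sub_mul (hg 4) n]

lemma Carries.flows_close_nonempty (hP : P.Carries R 1) : (P.close.flows R).Nonempty := by
  have p := abs_mem_of_mem_flows hP
  refine ⟨fun e ↦ e.elim, mem_flows_close.2 ⟨![1 + 1, -1, -(1 + 1), 1, 1], ?_, ?_, hP⟩⟩
  · intro i
    fin_cases i
    exacts [p 0, p 1, p 2, p 3, p 3]
  · refine ⟨?_, ?_⟩ <;> simp

/-- Starting from a gadget that confines excesses to `a₁` for `R₁`, but carries excesses up to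
`a₂ > a₁` for `R₂`, one obtains a closed pole that separates `R₁` from `R₂`. The induction
increases `a₂ - a₁` by a factor at least two in each step. -/
lemma exists_separating_of_gadget {R₁ R₂ : ℝ} (hR₂ : R₂ < 4) (n : ℕ) :
    ∀ (a₁ a₂ : ℝ) (P : Pole (Fin 4)), 0 ≤ a₁ → a₁ < a₂ → a₁ ≤ R₁ - 3 → a₂ ≤ R₂ - 3 →
      1 ≤ 2 ^ n * (a₂ - a₁) → P.Confined R₁ a₁ → (∀ y ∈ Set.Icc 0 a₂, P.Carries R₂ y) →
      ∃ G : Pole Empty, G.flows R₁ = ∅ ∧ (G.flows R₂).Nonempty := by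
  induction n with
  | zero =>
    intro a₁ a₂ P h0 h12 h1 h2 hn
    norm_num at hn
    linarith
  | succ n ih =>
    intro a₁ a₂ P h0 h12 h1 h2 hn hP hc
    have h0' : 0 < a₂ := h0.trans_lt h12
    obtain ⟨N, hN⟩ : ∃ N, ⌈1 / a₂⌉₊ = N + 1 :=
      Nat.exists_eq_succ_of_ne_zero (Nat.ceil_pos.2 (by positivity)).ne'
    have hle : 1 ≤ ((N + 1 : ℕ) : ℝ) * a₂ := by
      rw [← hN, ← div_le_iff₀ h0']
      exact Nat.le_ceil _
    -- Minimality of `N + 1` gives `(N + 1) * a₂ - 1 < a₂`, so the upper bounds on the parameters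
    -- survive the step.
    have hlt : (N : ℝ) * a₂ < 1 := by
      rw [← lt_div_iff₀ h0']
      exact Nat.lt_ceil.1 (by omega)
    have hN1 : (1 : ℝ) ≤ N := by
      rcases Nat.eq_zero_or_pos N with rfl | h
      · norm_num at hle
        linarith
      · exact_mod_cast h
    obtain ⟨T, hT, hTc⟩ := exists_multiple hP hc N
    push_cast at hle hT hTc
    -- The amount `z` is split evenly among the `N + 1` copies.
    have carry (z : ℝ) (hz : 0 ≤ z) (hz' : z ≤ (N + 1) * a₂) : T.Carries R₂ z := by
      have e : ((N : ℝ) + 1) * (z / (N + 1)) = z := by field_simp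
      have := hTc (z / (N + 1)) ⟨by positivity, by rw [div_le_iff₀ (by positivity)]; linarith⟩
        (by rw [e]; linarith)
      rwa [e] at this
    rcases lt_or_ge ((N + 1) * a₁) 1 with hNa | hNa
    · exact ⟨T.close, hT.flows_close_eq_empty hNa,
        (carry 1 zero_le_one hle).flows_close_nonempty⟩
    · have hNa₁ : N * a₁ ≤ N * a₂ := mul_le_mul_of_nonneg_left h12.le (by linarith)
      refine ih ((N + 1) * a₁ - 1) ((N + 1) * a₂ - 1) (T.refine P) (by linarith)
        (by nlinarith) (by linarith) (by linarith) ?_ (hT.refine hP (by linarith) (by linarith))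
        fun y hy ↦ ?_
      · have : 2 ^ n * (2 * (a₂ - a₁)) ≤ 2 ^ n * ((N + 1) * a₂ - 1 - ((N + 1) * a₁ - 1)) := by
          gcongr
          nlinarith
        rw [pow_succ] at hn
        linarith
      · exact Carries.refine (carry _ (by linarith [hy.1]) (by linarith [hy.2]))
          (carry 1 zero_le_one hle) (hc y ⟨hy.1, by linarith [hy.2]⟩)

lemma exists_separating {R₁ R₂ : ℝ} (h3 : 3 ≤ R₁) (h12 : R₁ < R₂) (hR₂ : R₂ < 4) :
    ∃ G : Pole Empty, G.flows R₁ = ∅ ∧ (G.flows R₂).Nonempty := by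
  obtain ⟨n, hn⟩ := pow_unbounded_of_one_lt (1 / (R₂ - R₁)) one_lt_two
  refine exists_separating_of_gadget hR₂ n (R₁ - 3) (R₂ - 3) petersen (by linarith) (by linarith)
    le_rfl le_rfl ?_ (confined_petersen h3 (by linarith)) fun y hy ↦
      carries_petersen (by linarith) hy.1 hy.2
  rw [div_lt_iff₀ (by linarith)] at hn
  linarith

end Pole

/-! ### From closed poles to cubic graphs -/

namespace Pole

variable (P : Pole Empty)

/-- The half-edges of a closed pole are the halves of its edges. -/
def halfEdge : P.V × Fin 3 ≃ P.E × Bool := P.attach.trans (Equiv.emptySum _ _)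

lemma attach_eq (h : P.V × Fin 3) : P.attach h = .inr (P.halfEdge h) := by
  rw [halfEdge, Equiv.trans_apply]
  rcases P.attach h with i | p
  · exact i.elim
  · rfl

/-- The two ends of an edge of a closed pole. -/
def endAt (e : P.E) (s : Bool) : P.V := (P.halfEdge.symm (e, s)).1

lemma endAt_halfEdge (h : P.V × Fin 3) : P.endAt (P.halfEdge h).1 (P.halfEdge h).2 = h.1 := by
  simp [endAt]

lemma exists_halfEdge_eq {e : P.E} {s : Bool} {v : P.V} (h : P.endAt e s = v) :
    ∃ j, P.halfEdge (v, j) = (e, s) :=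
  ⟨(P.halfEdge.symm (e, s)).2, by simp [← h, endAt]⟩

/-- The graph of a closed pole. -/
def graph : Graph P.V P.E where
  vertexSet := Set.univ
  IsLink e x y := (x = P.endAt e true ∧ y = P.endAt e false) ∨
    (x = P.endAt e false ∧ y = P.endAt e true)
  isLink_symm _ _ := ⟨fun _ _ h ↦ h.symm.imp And.symm And.symm⟩
  eq_or_eq_of_isLink_of_isLink := by
    rintro e x y v w (⟨rfl, rfl⟩ | ⟨rfl, rfl⟩) (⟨rfl, rfl⟩ | ⟨rfl, rfl⟩) <;> simp
  left_mem_of_isLink _ _ _ _ := Set.mem_univ _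

variable {P}

lemma isLink_graph {e : P.E} {x y : P.V} : P.graph.IsLink e x y ↔
    (x = P.endAt e true ∧ y = P.endAt e false) ∨ (x = P.endAt e false ∧ y = P.endAt e true) :=
  Iff.rfl

lemma mem_edgeSet_graph (e : P.E) : e ∈ E(P.graph) :=
  (isLink_graph.2 (Or.inl ⟨rfl, rfl⟩)).edge_mem

lemma inc_graph {e : P.E} {x : P.V} : P.graph.Inc e x ↔ ∃ s, P.endAt e s = x := by
  simp only [Graph.Inc, isLink_graph, Bool.exists_bool]
  constructor
  · rintro ⟨y, ⟨rfl, -⟩ | ⟨rfl, -⟩⟩ <;> simp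
  · rintro (rfl | rfl)
    exacts [⟨_, .inr ⟨rfl, rfl⟩⟩, ⟨_, .inl ⟨rfl, rfl⟩⟩]

/-- A pole with a flow has no loop: the third half-edge at a vertex with a loop would carry `0`. -/
lemma endAt_true_ne_endAt_false {R : ℝ} (hP : (P.flows R).Nonempty) (e : P.E) :
    P.endAt e true ≠ P.endAt e false := by
  intro h
  obtain ⟨b, f, hf⟩ := hP
  obtain ⟨i, hi⟩ := P.exists_halfEdge_eq h
  obtain ⟨j, hj⟩ := P.exists_halfEdge_eq (rfl : P.endAt e false = _)
  have hij : i ≠ j := by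
    rintro rfl
    simpa using hi.symm.trans hj
  have third : ∀ i j : Fin 3, i ≠ j → ∃ k, ∀ g : Fin 3 → ℝ, ∑ l, g l = g i + g j + g k := by
    intro i j hij
    have : ∃ k, k ≠ i ∧ k ≠ j := by decide +revert
    obtain ⟨k, hki, hkj⟩ := this
    refine ⟨k, fun g ↦ ?_⟩
    have : (Finset.univ : Finset (Fin 3)) = {i, j, k} := by decide +revert
    rw [this, Finset.sum_insert (by simp [hij, hki.symm]), Finset.sum_pair hkj.symm, add_assoc]
  obtain ⟨k, hk⟩ := third i j hij
  have cons := hf.conserve (P.endAt e false)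
  rw [hk, attach_eq, attach_eq, attach_eq, hi, hj] at cons
  have ne_zero : ∀ p, halfEdgeValue b f (.inr p) ≠ 0 := by
    rintro ⟨e, s⟩ h
    have hfe := (hf.edge e).1
    have : f e = 0 := by cases s <;> simpa [halfEdgeValue] using h
    norm_num [this] at hfe
  exact ne_zero _ (by simpa [halfEdgeValue] using cons)

lemma isCubic_graph {R : ℝ} (hP : (P.flows R).Nonempty) : IsCubic P.graph where
  finite_vertexSet := Set.toFinite _
  loopless := by
    refine ⟨fun e x h ↦ ?_⟩
    rcases isLink_graph.1 h with ⟨h1, h2⟩ | ⟨h1, h2⟩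
    · exact endAt_true_ne_endAt_false hP e (h1.symm.trans h2)
    · exact endAt_true_ne_endAt_false hP e (h2.symm.trans h1)
  ncard_incidenceSet x _ := by
    have range : P.graph.incidenceSet x = Set.range fun j ↦ (P.halfEdge (x, j)).1 := by
      ext e
      rw [Graph.mem_incidenceSet, inc_graph, Set.mem_range]
      constructor
      · rintro ⟨s, hs⟩
        obtain ⟨j, hj⟩ := P.exists_halfEdge_eq hs
        exact ⟨j, by rw [hj]⟩
      · rintro ⟨j, rfl⟩
        exact ⟨_, P.endAt_halfEdge (x, j)⟩
    -- Two half-edges of the same edge at `x` would form a loop.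
    have inj : Function.Injective fun j ↦ (P.halfEdge (x, j)).1 := by
      intro i j hij
      have hi := P.endAt_halfEdge (x, i)
      have hj := P.endAt_halfEdge (x, j)
      have key : P.halfEdge (x, i) = P.halfEdge (x, j) := by
        refine Prod.ext hij ?_
        simp only at hij hi hj
        rw [hij] at hi
        by_contra hne
        have := endAt_true_ne_endAt_false hP (P.halfEdge (x, j)).1
        cases h1 : (P.halfEdge (x, i)).2 <;> cases h2 : (P.halfEdge (x, j)).2 <;>
          simp_all
      simpa using P.halfEdge.injective key
    rw [range, ← Set.image_univ, Set.ncard_image_of_injective _ inj, Set.ncard_univ]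
    simp

open Classical in
-- Both sides count half-edges at `v`: `g` is `F` with a sign comparing the orientation with the
-- reference direction from the `true` end to the `false` end.
lemma excess_eq (D : Orientation P.graph) (F : E(P.graph) → ℝ) (b : Empty → ℝ) (g : P.E → ℝ)
    (hg : ∀ e : E(P.graph),
      (D.tail e = P.endAt e true ∧ D.head e = P.endAt e false ∧ g e = F e) ∨
        (D.tail e = P.endAt e false ∧ D.head e = P.endAt e true ∧ g e = -F e)) (v : P.V) :
    (∑ᶠ e ∈ D.outEdges v, F e) - ∑ᶠ e ∈ D.inEdges v, F e =
      ∑ j, halfEdgeValue b g (P.attach (v, j)) := by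
  have to_sum (s : Set E(P.graph)) : ∑ᶠ e ∈ s, F e = ∑ e, if e ∈ s then F e else 0 := by
    rw [finsum_mem_def, finsum_eq_sum_of_fintype]
    rfl
  have edges : ∑ e : E(P.graph), ∑ s, (if P.endAt e s = v then
      halfEdgeValue b g (.inr (e.1, s)) else 0) =
      ∑ e : P.E, ∑ s, if P.endAt e s = v then halfEdgeValue b g (.inr (e, s)) else 0 :=
    Fintype.sum_equiv (Equiv.subtypeUnivEquiv mem_edgeSet_graph) _ _ fun _ ↦ rfl
  rw [to_sum, to_sum, ← Finset.sum_sub_distrib]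
  calc _ = ∑ e : E(P.graph), ∑ s, if P.endAt e s = v then
        halfEdgeValue b g (.inr (e.1, s)) else 0 := by
        refine Fintype.sum_congr _ _ fun e ↦ ?_
        rw [Fintype.sum_bool]
        have out : e ∈ D.outEdges v ↔ D.tail e = v := Iff.rfl
        have into : e ∈ D.inEdges v ↔ D.head e = v := Iff.rfl
        rcases hg e with ⟨h1, h2, h3⟩ | ⟨h1, h2, h3⟩ <;>
          simp only [out, into, halfEdgeValue, h1, h2, h3] <;> split_ifs <;> simp
    _ = ∑ p : P.E × Bool, if P.endAt p.1 p.2 = v then halfEdgeValue b g (.inr p) else 0 := by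
        rw [edges, Fintype.sum_prod_type]
    _ = ∑ h : P.V × Fin 3, if h.1 = v then halfEdgeValue b g (P.attach h) else 0 := by
        rw [← P.halfEdge.sum_comp]
        exact Fintype.sum_congr _ _ fun h ↦ by rw [endAt_halfEdge, attach_eq]
    _ = _ := by
        rw [Fintype.sum_prod_type, Fintype.sum_eq_single v fun w hw ↦ by simp [hw]]
        simp

open Classical in
lemma admits_graph {R : ℝ} : Admits P.graph (R + 1, 0) ↔ (P.flows R).Nonempty := by
  constructor
  · rintro ⟨D, F, hF⟩
    let g : P.E → ℝ := fun e ↦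
      if D.tail ⟨e, mem_edgeSet_graph e⟩ = P.endAt e true then F ⟨e, mem_edgeSet_graph e⟩
      else -F ⟨e, mem_edgeSet_graph e⟩
    have hg (e : E(P.graph)) :
        (D.tail e = P.endAt e true ∧ D.head e = P.endAt e false ∧ g e = F e) ∨
          (D.tail e = P.endAt e false ∧ D.head e = P.endAt e true ∧ g e = -F e) := by
      by_cases h : D.tail e = P.endAt e true
      · have hge : g e = F e := if_pos h
        rcases isLink_graph.1 (D.isLink e) with ⟨-, h2⟩ | ⟨h1, h2⟩
        · exact .inl ⟨h, h2, hge⟩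
        -- Here the two ends of the edge coincide, so both names for the head agree.
        · exact .inl ⟨h, h2.trans (h.symm.trans h1), hge⟩
      · have hge : g e = -F e := if_neg h
        rcases isLink_graph.1 (D.isLink e) with ⟨h1, -⟩ | ⟨h1, h2⟩
        · exact (h h1).elim
        · exact .inr ⟨h1, h2, hge⟩
    have b : Empty → ℝ := fun i ↦ i.elim
    refine ⟨b, g, fun i ↦ i.elim, fun e ↦ ?_, fun v ↦ ?_⟩
    · have mem := hF.mem_Icc ⟨e, mem_edgeSet_graph e⟩
      rw [add_sub_cancel_right] at mem
      rcases hg ⟨e, mem_edgeSet_graph e⟩ with ⟨-, -, h⟩ | ⟨-, -, h⟩ <;> simp only at h <;> rw [h]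
      · rwa [abs_of_nonneg (zero_le_one.trans mem.1)]
      · rwa [abs_neg, abs_of_nonneg (zero_le_one.trans mem.1)]
    · rw [← excess_eq D F b g hg v]
      exact abs_nonpos_iff.1 (hF.abs_excess_le v (Set.mem_univ v))
  · rintro ⟨b, f, hf⟩
    let D : Orientation P.graph :=
      { tail := fun e ↦ if 0 ≤ f e then P.endAt e true else P.endAt e false
        head := fun e ↦ if 0 ≤ f e then P.endAt e false else P.endAt e true
        isLink := fun e ↦ isLink_graph.2 (by split_ifs <;> simp) }
    refine ⟨D, fun e ↦ |f e|, fun e ↦ ?_, fun v _ ↦ ?_⟩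
    · rw [add_sub_cancel_right]
      exact hf.edge e
    · rw [excess_eq D _ b f (fun e ↦ ?_) v, hf.conserve v, abs_zero]
      by_cases h : 0 ≤ f e
      · exact .inl ⟨if_pos h, if_pos h, (abs_of_nonneg h).symm⟩
      · exact .inr ⟨if_neg h, if_neg h, by rw [abs_of_neg (not_le.1 h), neg_neg]⟩

end Pole

/-! ### Non-equivalence on the segment -/

lemma Admits.mono {V E : Type} {G : Graph V E} {r s α : ℝ} (h : Admits G (r, α)) (hrs : r ≤ s) :
    Admits G (s, α) := by
  obtain ⟨D, f, hf⟩ := h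
  exact ⟨D, f, fun e ↦ ⟨(hf.mem_Icc e).1, (hf.mem_Icc e).2.trans (sub_le_sub_right hrs 1)⟩,
    hf.abs_excess_le⟩

/-- For `4 ≤ r < s ≤ 5`, some cubic graph has an `s`-flow but no `r`-flow. -/
lemma not_strongerOrEquiv {r s : ℝ} (hr : 4 ≤ r) (hrs : r < s) (hs : s ≤ 5) :
    ¬ StrongerOrEquiv (s, 0) (r, 0) := by
  intro h
  -- The intermediate `m` keeps `R₂ = m - 1` strictly below `4` even when `s = 5`.
  obtain ⟨m, hrm, hms⟩ := exists_between hrs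
  obtain ⟨P, hP₁, hP₂⟩ := Pole.exists_separating (R₁ := r - 1) (R₂ := m - 1) (by linarith)
    (by linarith) (by linarith)
  have hm : Admits P.graph (m, 0) := by simpa using Pole.admits_graph.2 hP₂
  have := h _ _ P.graph (Pole.isCubic_graph hP₂) (hm.mono hms.le)
  rw [show r = r - 1 + 1 by ring, Pole.admits_graph, hP₁] at this
  exact Set.not_nonempty_empty this

lemma not_equivalent_of_ne {p q : ℝ × ℝ} (hp : p ∈ segment ℝ ((4, 0) : ℝ × ℝ) (5, 0))
    (hq : q ∈ segment ℝ ((4, 0) : ℝ × ℝ) (5, 0)) (hpq : p ≠ q) : ¬ Equivalent p q := by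
  rw [← Prod.image_mk_segment_left, segment_eq_Icc (by norm_num)] at hp hq
  obtain ⟨r, ⟨hr4, hr5⟩, rfl⟩ := hp
  obtain ⟨s, ⟨hs4, hs5⟩, rfl⟩ := hq
  rintro ⟨h₁, h₂⟩
  rcases lt_or_gt_of_ne (fun h : r = s ↦ hpq (by rw [h])) with h | h
  · exact not_strongerOrEquiv hr4 h hs5 h₂
  · exact not_strongerOrEquiv hs4 h hr5 h₁

end BoundedExcess

theorem theorem18 :
    (∃ S : Set (ℝ × ℝ), S ⊆ BoundedExcess.plane ∧ S.Infinite ∧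
      ∀ p ∈ S, ∀ q ∈ S, p ≠ q → ¬ BoundedExcess.Equivalent p q) ∧
    (∀ p ∈ segment ℝ ((4, 0) : ℝ × ℝ) (5, 0), ∀ q ∈ segment ℝ ((4, 0) : ℝ × ℝ) (5, 0),
      p ≠ q → ¬ BoundedExcess.Equivalent p q) := by
  refine ⟨⟨segment ℝ ((4, 0) : ℝ × ℝ) (5, 0), ?_, ?_,
    fun p hp q hq ↦ BoundedExcess.not_equivalent_of_ne hp hq⟩,
    fun p hp q hq ↦ BoundedExcess.not_equivalent_of_ne hp hq⟩
  · rw [← Prod.image_mk_segment_left, segment_eq_Icc (by norm_num)]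
    rintro _ ⟨r, ⟨hr, -⟩, rfl⟩
    exact ⟨by linarith, le_rfl⟩
  · rw [← Prod.image_mk_segment_left, segment_eq_Icc (by norm_num)]
    exact (Set.Icc_infinite (by norm_num)).image fun _ _ _ _ h ↦ congrArg Prod.fst h
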